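/- Let $F\colon T^2\to\mathbb R^n$ be a smooth immersion of the 2-dimensional torus, let $g:=F^*g_{\mathrm{eucl}}$ be the induced metric, and let $$W(F):=\int_{T^2}|H|^2\,\mathrm{darea}_g$$ be its Willmore functional, where $H=\tfrac12\operatorname{tr}_g \mathrm{II}$ is the mean curvature vector of $F$ (half the trace of the vector-valued second fundamental form). Let $(x,y)\in\mathbb R^2$ satisfy $0\le x\le \tfrac12$, $x^2+y^2\ge 1$ and $y\ge 0$, let $\Gamma_{xy}\subset\mathbb R^2$ be the lattice generated by $(1,0)$ and $(x,y)$, and let $g_0$ be the flat metric on $\mathbb R^2/\Gamma_{xy}$ induced by the Euclidean metric of $\mathbb R^2$. Suppose that $(T^2,g)$ is isometric to $(\mathbb R^2/\Gamma_{xy},\,e^{2u}g_0)$ for a smooth function $u\colon\mathbb R^2/\Gamma_{xy}\to\mathbb R$, and put $\operatorname{osc}u:=\max u-\min u$. Then $$W(F)\;\ge\; e^{-2\operatorname{osc}u}\,\pi^2\Bigl(y+\frac1y\Bigr).$$ -/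

import Mathlib

open scoped Manifold ContDiff RealInnerProductSpace

noncomputable section

namespace WillmoreTorus

/-- The Euclidean space `ℝⁿ`. -/
abbrev E (n : ℕ) : Type := EuclideanSpace ℝ (Fin n)

/-! ### The torus and its immersions -/

/-- The smooth 2-torus `T² = S¹ × S¹`, with the product manifold structure. -/
abbrev T2 : Type := Circle × Circle

/-- The model with corners of the 2-torus. -/
abbrev T2Model : ModelWithCorners ℝ (E 1 × E 1) (ModelProd (E 1) (E 1)) :=
  (𝓡 1).prod (𝓡 1)

/-- `F : T² → ℝⁿ` is a smooth immersion. -/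
def IsSmoothImmersion {n : ℕ} (F : T2 → E n) : Prop :=
  Manifold.IsImmersion T2Model 𝓘(ℝ, E n) ∞ F

/-- The induced metric `F^* g_eucl` on `T²`, at the point `p`. -/
def inducedMetric {n : ℕ} (F : T2 → E n) (p : T2) (v w : TangentSpace T2Model p) : ℝ :=
  inner (E := E n) ℝ (mfderiv T2Model 𝓘(ℝ, E n) F p v) (mfderiv T2Model 𝓘(ℝ, E n) F p w)

/-! ### The Willmore functional

For a parametrized surface patch `f : ℝ² → ℝⁿ` we define the first fundamental form, the vector
valued second fundamental form and the mean curvature vector. -/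

/-- The standard basis vectors of the parameter plane `ℝ²`. -/
def stdVec (i : Fin 2) : E 2 := EuclideanSpace.single i 1

/-- The first fundamental form `g_{ij} = ⟨∂_i f, ∂_j f⟩`. -/
def firstFundamentalForm {n : ℕ} (f : E 2 → E n) (w : E 2) : Matrix (Fin 2) (Fin 2) ℝ :=
  Matrix.of fun i j => inner ℝ (fderiv ℝ f w (stdVec i)) (fderiv ℝ f w (stdVec j))

/-- The normal space: the orthogonal complement of the image of the differential. -/
def normalSpace {n : ℕ} (f : E 2 → E n) (w : E 2) : Submodule ℝ (E n) :=
  (LinearMap.range (fderiv ℝ f w).toLinearMap)ᗮ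

/-- The second fundamental form `II_{ij} = (∂_i ∂_j f)^⊥`, a normal vector. -/
def secondFundamentalForm {n : ℕ} (f : E 2 → E n) (w : E 2) (i j : Fin 2) : E n :=
  (normalSpace f w).starProjection (fderiv ℝ (fderiv ℝ f) w (stdVec i) (stdVec j))

/-- The mean curvature vector `H = (1/2) tr_g II = (1/2) ∑_{ij} g^{ij} II_{ij}`. -/
def meanCurvature {n : ℕ} (f : E 2 → E n) (w : E 2) : E n :=
  (1 / 2 : ℝ) • ∑ i, ∑ j, (firstFundamentalForm f w)⁻¹ i j • secondFundamentalForm f w i j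

/-- The density of the area form of the induced metric with respect to Lebesgue measure. -/
def areaDensity {n : ℕ} (f : E 2 → E n) (w : E 2) : ℝ :=
  Real.sqrt (firstFundamentalForm f w).det

/-- Angular coordinates on the torus, `(s, t) ↦ (e^{2πis}, e^{2πit})`. -/
def angular (w : E 2) : T2 :=
  (Circle.exp (2 * Real.pi * w 0), Circle.exp (2 * Real.pi * w 1))

/-- The unit square, on which `angular` is a bijection onto the torus. -/
def unitSquare : Set (E 2) := {w | ∀ i, w i ∈ Set.Ico (0 : ℝ) 1}

/-- The Willmore functional `W(F) = ∫_{T²} |H|² darea`, with the integral computed in angular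
coordinates. -/
def willmore {n : ℕ} (F : T2 → E n) : ℝ :=
  ∫ w in unitSquare, ‖meanCurvature (F ∘ angular) w‖ ^ 2 * areaDensity (F ∘ angular) w

/-! ### Flat tori and conformal metrics on them -/

/-- The set `𝓜` of parameters of the moduli space of conformal structures. -/
def moduliDomain : Set (ℝ × ℝ) :=
  {z | 0 ≤ z.1 ∧ z.1 ≤ 1 / 2 ∧ 1 ≤ z.1 ^ 2 + z.2 ^ 2 ∧ 0 ≤ z.2}

/-- The subgroup `Γ_{xy}` of `ℝ²` generated by `(1, 0)` and `(x, y)`. -/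
def lattice (x y : ℝ) : AddSubgroup (E 2) :=
  AddSubgroup.closure {!₂[1, 0], !₂[x, y]}

/-- The quotient `ℝ² / Γ_{xy}`. -/
abbrev FlatTorus (x y : ℝ) : Type := E 2 ⧸ lattice x y

/-- The projection `ℝ² → ℝ² / Γ_{xy}`. -/
def proj (x y : ℝ) (w : E 2) : FlatTorus x y := QuotientAddGroup.mk w

/-- Smoothness of a function on `ℝ² / Γ_{xy}`; the smooth structure of the quotient is the one for
which the projection is a local diffeomorphism, so this is smoothness of the pullback to `ℝ²`. -/
def IsSmooth {x y : ℝ} (u : FlatTorus x y → ℝ) : Prop :=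
  ContDiff ℝ ∞ (u ∘ proj x y)

/-- A homeomorphism `ψ : ℝ² / Γ_{xy} → T²` is a diffeomorphism: the smooth structure of the quotient
is the one for which the projection is a local diffeomorphism, so this says that the composition
of `ψ` with the projection is a local diffeomorphism. -/
def IsDiffeo {x y : ℝ} (ψ : FlatTorus x y ≃ₜ T2) : Prop :=
  IsLocalDiffeomorph 𝓘(ℝ, E 2) T2Model ∞ (ψ ∘ proj x y)

/-- `T²` with the metric induced by `F` is isometric to `(ℝ² / Γ_{xy}, e^{2u} g₀)`: there is a
diffeomorphism `ψ : ℝ² / Γ_{xy} → T²` with `ψ^* F^* g_eucl = e^{2u} g₀`. Every tangent vector of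
the quotient is the image of a vector of `ℝ²` under the differential of the projection, which is
isometric for `g₀`; so the equality is expressed on `ℝ²`. -/
def InducedMetricIsometric {n : ℕ} (F : T2 → E n) (x y : ℝ) (u : FlatTorus x y → ℝ) : Prop :=
  ∃ ψ : FlatTorus x y ≃ₜ T2, IsDiffeo ψ ∧ ∀ w v v' : E 2,
    inducedMetric F (ψ (proj x y w))
        (mfderiv 𝓘(ℝ, E 2) T2Model (ψ ∘ proj x y) w v)
        (mfderiv 𝓘(ℝ, E 2) T2Model (ψ ∘ proj x y) w v') =
      Real.exp (2 * u (proj x y w)) * inner ℝ v v'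

/-- The oscillation `max u - min u` of a (continuous) function on the compact `ℝ² / Γ_{xy}`. -/
def osc {x y : ℝ} (u : FlatTorus x y → ℝ) : ℝ := (⨆ p, u p) - ⨅ p, u p

end WillmoreTorus

end

noncomputable section

namespace WillmoreTorus

open MeasureTheory Set

/-! ### The one-dimensional Wirtinger inequality -/

/-! Write `f = F ∘ ψ ∘ proj x y`, a doubly periodic conformal map of the plane with factor `λ =
e^{2u}`. The Laplacian of a conformal map is normal, so `H = Δf / (2λ)` while the area form is `λ
dw`. Hence `W(F) = ∫ |Δf|² / (4λ)` over the cell `[0,1) × [0,y)` (`willmore_eq_cellIntegral`), which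
is at least `(4 max λ)⁻¹ ∫ |Δf|²`.

The analytic core is `cellIntegral_laplacian_sq_ge`: for a periodic function `φ`, `∫ (Δφ)² ≥ 4π² (∫
φ₀² + y⁻² ∫ φ₁²)`. It is proved with one-dimensional Wirtinger inequalities only. Integration by
parts gives `∫ (Δφ)² = ∫ φ₀₀² + 2 ∫ φ₀₁² + ∫ φ₁₁²`. The rows have period 1, which controls `φ₀` and
the deviation of `φ₁` from its row mean. The row mean of `φ₁` is a `y`-periodic function of mean
zero, controlled by `φ₁₁`.

Summing over the coordinates of `f` and using `|f₀|² = |f₁|² = λ` gives `∫ |Δf|² ≥ 4π² (1 + y⁻²) ∫ λ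
≥ 4π² (1 + y⁻²) y min λ`. The quotient `min λ / max λ` is `e^{-2 osc u}`.

Since `willmore` is an integral in angular coordinates, `ψ ∘ proj x y` is lifted through `angular`
to a map `Φ` of the plane. The image of the cell under `Φ` is another fundamental domain of `ℤ²`,
and the change of variables formula applies. -/

lemma normSq_fourierCoeffOn_deriv {T : ℝ} (hT : 0 < T) {h h' : ℝ → ℂ}
    (hd : ∀ s, HasDerivAt h (h' s) s) (hc : Continuous h') (hper : h T = h 0) {k : ℤ}
    (hk : k ≠ 0) :
    ‖fourierCoeffOn hT h' k‖ ^ 2 = (2 * Real.pi * k / T) ^ 2 * ‖fourierCoeffOn hT h k‖ ^ 2 := by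
  have key := fourierCoeffOn_of_hasDerivAt hT hk (fun s _ => hd s) (hc.intervalIntegrable 0 T)
  rw [key, hper]
  have hk' : (k : ℝ) ≠ 0 := by exact_mod_cast hk
  have hpi := Real.pi_ne_zero
  simp only [sub_self, mul_zero, zero_sub, norm_mul, norm_neg, norm_div, norm_one, Complex.ofReal_zero,
    sub_zero, Complex.norm_real, Complex.norm_I, Complex.norm_intCast, Complex.norm_two,
    Real.norm_eq_abs, abs_of_pos hT, abs_of_pos Real.pi_pos, mul_one]
  have : |(k : ℝ)| ^ 2 = (k : ℝ) ^ 2 := sq_abs _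
  have h2 : |(k : ℝ)| ≠ 0 := abs_ne_zero.mpr hk'
  field_simp
  rw [this]

/-- **Wirtinger's inequality** for a `C¹` function on `[0, T]` with equal boundary values. -/
theorem wirtinger {T : ℝ} (hT : 0 < T) {h h' : ℝ → ℝ} (hd : ∀ s, HasDerivAt h (h' s) s)
    (hc : Continuous h') (hper : h T = h 0) :
    (2 * Real.pi / T) ^ 2 * ((∫ s in 0..T, h s ^ 2) - (∫ s in 0..T, h s) ^ 2 / T) ≤
      ∫ s in 0..T, h' s ^ 2 := by
  have hcont : Continuous h := continuous_iff_continuousAt.mpr fun s => (hd s).continuousAt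
  have parseval : ∀ f : ℝ → ℝ, Continuous f →
      HasSum (fun k => ‖fourierCoeffOn hT (fun s => (f s : ℂ)) k‖ ^ 2)
        (T⁻¹ * ∫ s in 0..T, f s ^ 2) := by
    intro f hf
    have hL2 : MemLp (fun s => (f s : ℂ)) 2 (volume.restrict (Ioc 0 T)) :=
      (memLp_two_iff_integrable_sq_norm
        (Complex.continuous_ofReal.comp hf).aestronglyMeasurable).mpr
        (Continuous.integrableOn_Ioc (by fun_prop))
    simpa using hasSum_sq_fourierCoeffOn hT hL2
  have h0 : ‖fourierCoeffOn hT (fun s => (h s : ℂ)) 0‖ ^ 2 = (∫ s in 0..T, h s) ^ 2 / T ^ 2 := by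
    rw [fourierCoeffOn_eq_integral]
    simp only [neg_zero, fourier_zero, one_smul, sub_zero, intervalIntegral.integral_ofReal,
      norm_smul, Complex.norm_real, Real.norm_eq_abs, mul_pow, sq_abs]
    ring
  -- Removing the zero mode, which is the mean, leaves a termwise comparison in which only `k² ≥ 1`
  -- for `k ≠ 0` is needed.
  have hs := ((parseval h hcont).sub (hasSum_ite_eq (0 : ℤ)
    (‖fourierCoeffOn hT (fun s => (h s : ℂ)) 0‖ ^ 2))).mul_left ((2 * Real.pi / T) ^ 2)
  have hle := hasSum_le (fun k => ?_) hs (parseval h' hc)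
  · rw [h0] at hle
    have := mul_le_mul_of_nonneg_left hle hT.le
    calc _ = T * ((2 * Real.pi / T) ^ 2 *
          (T⁻¹ * (∫ s in 0..T, h s ^ 2) - (∫ s in 0..T, h s) ^ 2 / T ^ 2)) := by field_simp
      _ ≤ _ := this
      _ = _ := by field_simp
  · by_cases hk : k = 0
    · simp [hk]
    · rw [normSq_fourierCoeffOn_deriv hT (fun s => (hd s).ofReal_comp)
        (Complex.continuous_ofReal.comp hc) (by simp [hper]) hk]
      simp only [hk, if_false, sub_zero]
      refine mul_le_mul_of_nonneg_right ?_ (by positivity)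
      have h1 : (1 : ℝ) ≤ (k : ℝ) ^ 2 := by
        have : 1 ≤ k ^ 2 := Int.one_le_abs (pow_ne_zero 2 hk) |>.trans_eq (abs_of_nonneg (sq_nonneg k))
        exact_mod_cast this
      calc (2 * Real.pi / T) ^ 2 ≤ (2 * Real.pi / T) ^ 2 * (k : ℝ) ^ 2 :=
            le_mul_of_one_le_right (sq_nonneg _) h1
        _ = _ := by ring

/-- Jensen's inequality for the square on an interval of length one. -/
lemma sq_intervalIntegral_le {h : ℝ → ℝ} (hc : Continuous h) :
    (∫ s in (0 : ℝ)..1, h s) ^ 2 ≤ ∫ s in (0 : ℝ)..1, h s ^ 2 := by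
  set m := ∫ s in (0 : ℝ)..1, h s with hm
  have h0 : 0 ≤ ∫ s in (0 : ℝ)..1, (h s - m) ^ 2 :=
    intervalIntegral.integral_nonneg zero_le_one fun s _ => sq_nonneg _
  have h1 : ∫ s in (0 : ℝ)..1, (h s - m) ^ 2 = (∫ s in (0 : ℝ)..1, h s ^ 2) - m ^ 2 := by
    have : ∀ s, (h s - m) ^ 2 = h s ^ 2 - (2 * m) * h s + m ^ 2 := fun s => by ring
    simp only [this]
    rw [intervalIntegral.integral_add
        (Continuous.intervalIntegrable (by fun_prop) _ _)
        (Continuous.intervalIntegrable (by fun_prop) _ _),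
      intervalIntegral.integral_sub
        (Continuous.intervalIntegrable (by fun_prop) _ _)
        (Continuous.intervalIntegrable (by fun_prop) _ _),
      intervalIntegral.integral_const_mul, ← hm, intervalIntegral.integral_const]
    simp only [sub_zero, smul_eq_mul]
    ring
  linarith

/-! ### Partial derivatives on the plane -/

/-- The `i`-th partial derivative. -/
def pd {V : Type*} [NormedAddCommGroup V] [NormedSpace ℝ V] (i : Fin 2) (φ : E 2 → V) (w : E 2) :
    V := fderiv ℝ φ w (stdVec i)

section pd

variable {V : Type*} [NormedAddCommGroup V] [NormedSpace ℝ V] {φ : E 2 → V}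

lemma contDiff_pd (hφ : ContDiff ℝ ∞ φ) (i : Fin 2) : ContDiff ℝ ∞ (pd i φ) :=
  (hφ.fderiv_right (by simp)).clm_apply contDiff_const

lemma pd_add_const (φ : E 2 → V) {c : E 2} (h : ∀ w, φ (w + c) = φ w) (i : Fin 2) (w : E 2) :
    pd i φ (w + c) = pd i φ w := by
  have : (fun w => φ (w + c)) = φ := funext h
  simp only [pd]
  rw [← fderiv_comp_add_right, this]

lemma pd_pd (hφ : ContDiff ℝ ∞ φ) (i j : Fin 2) (w : E 2) :
    pd i (pd j φ) w = fderiv ℝ (fderiv ℝ φ) w (stdVec i) (stdVec j) := by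
  have hd : DifferentiableAt ℝ (fderiv ℝ φ) w :=
    ((hφ.fderiv_right (m := ∞) (by simp)).differentiable (by simp)).differentiableAt
  unfold pd
  rw [fderiv_clm_apply hd (differentiableAt_const _)]
  simp

lemma pd_comm (hφ : ContDiff ℝ ∞ φ) (i j : Fin 2) : pd i (pd j φ) = pd j (pd i φ) := by
  ext w
  rw [pd_pd hφ, pd_pd hφ]
  exact (hφ.contDiffAt.isSymmSndFDerivAt (by
    rw [minSmoothness_of_isRCLikeNormedField]
    exact WithTop.coe_le_coe.mpr (le_top : (2 : ℕ∞) ≤ ⊤))) _ _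

lemma point_eq (s t : ℝ) : (!₂[s, t] : E 2) = s • stdVec 0 + t • stdVec 1 := by
  ext i
  fin_cases i <;> simp [stdVec]

lemma hasDerivAt_pd_zero (hφ : ContDiff ℝ ∞ φ) (s t : ℝ) :
    HasDerivAt (fun s => φ !₂[s, t]) (pd 0 φ !₂[s, t]) s := by
  have h1 : HasDerivAt (fun s : ℝ => (!₂[s, t] : E 2)) (stdVec 0) s := by
    simpa only [← point_eq, one_smul, id] using
      ((hasDerivAt_id s).smul_const (stdVec 0)).add_const (t • stdVec 1)
  exact ((hφ.differentiable (by simp)) _).hasFDerivAt.comp_hasDerivAt s h1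

lemma hasDerivAt_pd_one (hφ : ContDiff ℝ ∞ φ) (s t : ℝ) :
    HasDerivAt (fun t => φ !₂[s, t]) (pd 1 φ !₂[s, t]) t := by
  have h1 : HasDerivAt (fun t : ℝ => (!₂[s, t] : E 2)) (stdVec 1) t := by
    simpa only [← point_eq, one_smul, id] using
      ((hasDerivAt_id t).smul_const (stdVec 1)).const_add (s • stdVec 0)
  exact ((hφ.differentiable (by simp)) _).hasFDerivAt.comp_hasDerivAt t h1

lemma pd_mul {φ χ : E 2 → ℝ} (hφ : ContDiff ℝ ∞ φ) (hχ : ContDiff ℝ ∞ χ) (i : Fin 2) (w : E 2) :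
    pd i (fun w => φ w * χ w) w = φ w * pd i χ w + pd i φ w * χ w := by
  unfold pd
  rw [fderiv_fun_mul (hφ.differentiable (by simp) _) (hχ.differentiable (by simp) _)]
  simp [mul_comm]

end pd

@[fun_prop]
lemma continuous_point {X : Type*} [TopologicalSpace X] {a b : X → ℝ} (ha : Continuous a)
    (hb : Continuous b) : Continuous fun p => (!₂[a p, b p] : E 2) := by
  refine (PiLp.continuous_toLp 2 _).comp (continuous_pi fun i => ?_)
  fin_cases i
  · exact ha
  · exact hb

/-! ### Averages over the first variable -/

/-- The average over the first variable. -/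
def rowMean (φ : E 2 → ℝ) (t : ℝ) : ℝ := ∫ s in (0 : ℝ)..1, φ !₂[s, t]

lemma continuous_rowMean {φ : E 2 → ℝ} (hφ : Continuous φ) : Continuous (rowMean φ) :=
  intervalIntegral.continuous_parametric_intervalIntegral_of_continuous' (f := fun t s => φ !₂[s, t])
    (by simp only [Function.uncurry_def]; fun_prop) 0 1

/-- Fubini and the fundamental theorem of calculus exhibit the row mean as a primitive of a
continuous function; this replaces differentiation under the integral sign. -/
lemma hasDerivAt_rowMean {φ : E 2 → ℝ} (hφ : ContDiff ℝ ∞ φ) (t : ℝ) :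
    HasDerivAt (rowMean φ) (rowMean (pd 1 φ) t) t := by
  have hc := (contDiff_pd hφ 1).continuous
  have hφc := hφ.continuous
  have key : ∀ r, rowMean φ r = rowMean φ 0 + ∫ τ in (0 : ℝ)..r, rowMean (pd 1 φ) τ := by
    intro r
    have hswap : ∫ τ in (0 : ℝ)..r, rowMean (pd 1 φ) τ =
        ∫ s in (0 : ℝ)..1, ∫ τ in (0 : ℝ)..r, pd 1 φ !₂[s, τ] := by
      unfold rowMean
      refine intervalIntegral_intervalIntegral_swap ?_
      have : Continuous (Function.uncurry fun τ s : ℝ => pd 1 φ !₂[s, τ]) := by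
        simp only [Function.uncurry_def]; fun_prop
      exact (this.continuousOn.integrableOn_compact
        (isCompact_uIcc.prod isCompact_uIcc)).mono_set
          (prod_mono uIoc_subset_uIcc uIoc_subset_uIcc)
    have hftc : ∀ s, ∫ τ in (0 : ℝ)..r, pd 1 φ !₂[s, τ] = φ !₂[s, r] - φ !₂[s, 0] := fun s =>
      intervalIntegral.integral_eq_sub_of_hasDerivAt (fun τ _ => hasDerivAt_pd_one hφ s τ)
        (Continuous.intervalIntegrable (by fun_prop) _ _)
    rw [hswap]
    simp only [hftc]
    rw [intervalIntegral.integral_sub (Continuous.intervalIntegrable (by fun_prop) _ _)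
      (Continuous.intervalIntegrable (by fun_prop) _ _)]
    simp [rowMean]
  have h1 := intervalIntegral.integral_hasDerivAt_right
    ((continuous_rowMean hc).intervalIntegrable 0 t)
    ((continuous_rowMean hc).stronglyMeasurableAtFilter _ _) (continuous_rowMean hc).continuousAt
  have h2 := h1.const_add (rowMean φ 0)
  rwa [← funext key] at h2

/-! ### The second order Wirtinger inequality on a flat torus -/

/-- Invariance under translation by `(1, 0)` and `(x, y)`. -/
def IsPeriodic {V : Type*} (x y : ℝ) (φ : E 2 → V) : Prop :=
  (∀ w, φ (w + !₂[1, 0]) = φ w) ∧ ∀ w, φ (w + !₂[x, y]) = φ w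

section IsPeriodic

variable {x y : ℝ}

lemma IsPeriodic.pd {V : Type*} [NormedAddCommGroup V] [NormedSpace ℝ V] {φ : E 2 → V}
    (h : IsPeriodic x y φ) (i : Fin 2) : IsPeriodic x y (pd i φ) :=
  ⟨pd_add_const φ h.1 i, pd_add_const φ h.2 i⟩

lemma IsPeriodic.mul {φ χ : E 2 → ℝ} (h : IsPeriodic x y φ) (h' : IsPeriodic x y χ) :
    IsPeriodic x y fun w => φ w * χ w :=
  ⟨fun w => by simp only [h.1 w, h'.1 w], fun w => by simp only [h.2 w, h'.2 w]⟩

lemma IsPeriodic.row {V : Type*} {φ : E 2 → V} (h : IsPeriodic x y φ) (t : ℝ) :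
    Function.Periodic (fun s => φ !₂[s, t]) 1 := fun s => by
  have : (!₂[s + 1, t] : E 2) = !₂[s, t] + !₂[1, 0] := by ext i; fin_cases i <;> simp
  simp only [this, h.1]

/-- Translation by `(x, y)` moves one row to another with a shift by `x`, and a shift does not
change the integral over a full period. Row means thus do not see the shear `x` of the lattice. -/
lemma IsPeriodic.rowMean_add {φ : E 2 → ℝ} (h : IsPeriodic x y φ) (t : ℝ) :
    rowMean φ (t + y) = rowMean φ t := by
  have h1 : rowMean φ (t + y) = ∫ s in (0 - x)..(1 - x), φ !₂[s + x, t + y] := by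
    rw [intervalIntegral.integral_comp_add_right (fun s => φ !₂[s, t + y])]
    simp [rowMean]
  have h2 : ∀ s, φ !₂[s + x, t + y] = φ !₂[s, t] := fun s => by
    have : (!₂[s + x, t + y] : E 2) = !₂[s, t] + !₂[x, y] := by ext i; fin_cases i <;> simp
    rw [this, h.2]
  rw [h1]
  simp only [h2]
  have := (h.row t).intervalIntegral_add_eq (0 - x) 0
  rw [show 0 - x + 1 = 1 - x by ring, zero_add] at this
  exact this

end IsPeriodic

/-- The integral over the rectangle `[0, 1] × [0, y]`. -/
def cellIntegral (y : ℝ) (φ : E 2 → ℝ) : ℝ := ∫ t in (0 : ℝ)..y, rowMean φ t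

section cellIntegral

variable {x y : ℝ} {φ χ : E 2 → ℝ}

lemma continuous_row (hφ : Continuous φ) (t : ℝ) : Continuous fun s => φ !₂[s, t] := by
  fun_prop

lemma rowMean_add (hφ : Continuous φ) (hχ : Continuous χ) :
    rowMean (fun w => φ w + χ w) = fun t => rowMean φ t + rowMean χ t := funext fun t =>
  intervalIntegral.integral_add ((continuous_row hφ t).intervalIntegrable _ _)
    ((continuous_row hχ t).intervalIntegrable _ _)

lemma rowMean_const_mul (c : ℝ) (φ : E 2 → ℝ) :
    rowMean (fun w => c * φ w) = fun t => c * rowMean φ t := funext fun _ =>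
  intervalIntegral.integral_const_mul _ _

lemma cellIntegral_add (hφ : Continuous φ) (hχ : Continuous χ) :
    cellIntegral y (fun w => φ w + χ w) = cellIntegral y φ + cellIntegral y χ := by
  unfold cellIntegral
  rw [rowMean_add hφ hχ]
  exact intervalIntegral.integral_add ((continuous_rowMean hφ).intervalIntegrable _ _)
    ((continuous_rowMean hχ).intervalIntegrable _ _)

lemma cellIntegral_const_mul (c : ℝ) (φ : E 2 → ℝ) :
    cellIntegral y (fun w => c * φ w) = c * cellIntegral y φ := by
  unfold cellIntegral
  rw [rowMean_const_mul]
  exact intervalIntegral.integral_const_mul _ _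

lemma rowMean_pd_zero (hφ : ContDiff ℝ ∞ φ) (hper : IsPeriodic x y φ) (t : ℝ) :
    rowMean (pd 0 φ) t = 0 := by
  have := intervalIntegral.integral_eq_sub_of_hasDerivAt (a := 0) (b := 1)
    (fun s _ => hasDerivAt_pd_zero hφ s t)
    ((continuous_row (contDiff_pd hφ 0).continuous t).intervalIntegrable _ _)
  rw [rowMean, this, sub_eq_zero]
  simpa using hper.row t 0

lemma cellIntegral_pd_zero (hφ : ContDiff ℝ ∞ φ) (hper : IsPeriodic x y φ) :
    cellIntegral y (pd 0 φ) = 0 := by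
  simp [cellIntegral, rowMean_pd_zero hφ hper]

lemma cellIntegral_pd_one (hφ : ContDiff ℝ ∞ φ) (hper : IsPeriodic x y φ) :
    cellIntegral y (pd 1 φ) = 0 := by
  have := intervalIntegral.integral_eq_sub_of_hasDerivAt (a := 0) (b := y)
    (fun s _ => hasDerivAt_rowMean hφ s)
    ((continuous_rowMean (contDiff_pd hφ 1).continuous).intervalIntegrable _ _)
  rw [cellIntegral, this, sub_eq_zero]
  simpa using hper.rowMean_add 0

/-- Integration by parts: `∫ φ₀₀ φ₁₁ = ∫ φ₀₁²`. -/
lemma cellIntegral_hessian (hφ : ContDiff ℝ ∞ φ) (hper : IsPeriodic x y φ) :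
    cellIntegral y (fun w => pd 0 (pd 0 φ) w * pd 1 (pd 1 φ) w) =
      cellIntegral y (fun w => pd 0 (pd 1 φ) w ^ 2) := by
  -- The derivatives `∂₀(φ₀ φ₁₁)` and `∂₁(φ₀ φ₀₁)` both integrate to zero and share the term `φ₀
  -- φ₀₁₁`.
  have s0 := contDiff_pd hφ 0
  have s1 := contDiff_pd hφ 1
  have s11 := contDiff_pd s1 1
  have s01 := contDiff_pd s1 0
  have p0 := hper.pd 0
  have p1 := hper.pd 1
  have h0 := cellIntegral_pd_zero (s0.mul s11) (p0.mul (p1.pd 1))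
  have h1 := cellIntegral_pd_one (s0.mul s01) (p0.mul (p1.pd 0))
  have e0 : pd 0 (fun w => pd 0 φ w * pd 1 (pd 1 φ) w) =
      fun w => pd 0 φ w * pd 0 (pd 1 (pd 1 φ)) w + pd 0 (pd 0 φ) w * pd 1 (pd 1 φ) w :=
    funext fun w => pd_mul s0 s11 0 w
  have e1 : pd 1 (fun w => pd 0 φ w * pd 0 (pd 1 φ) w) =
      fun w => pd 0 φ w * pd 0 (pd 1 (pd 1 φ)) w + pd 0 (pd 1 φ) w ^ 2 := by
    funext w
    rw [pd_mul s0 s01 1 w, pd_comm s1 1 0, pd_comm hφ 1 0, sq]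
  have c := (s0.mul (contDiff_pd s11 0)).continuous
  rw [e0, cellIntegral_add c ((contDiff_pd s0 0).mul s11).continuous] at h0
  rw [e1, cellIntegral_add c (s01.pow 2).continuous] at h1
  linarith

lemma intervalIntegral_mono_of_continuous {a b : ℝ → ℝ} (hy : 0 ≤ y) (ha : Continuous a)
    (hb : Continuous b) (hab : ∀ t, a t ≤ b t) :
    ∫ t in (0 : ℝ)..y, a t ≤ ∫ t in (0 : ℝ)..y, b t :=
  intervalIntegral.integral_mono hy (ha.intervalIntegrable _ _) (hb.intervalIntegrable _ _) hab

lemma cellIntegral_mono (hy : 0 ≤ y) (hφ : Continuous φ) (hχ : Continuous χ)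
    (h : ∀ w, φ w ≤ χ w) : cellIntegral y φ ≤ cellIntegral y χ :=
  intervalIntegral_mono_of_continuous hy (continuous_rowMean hφ) (continuous_rowMean hχ) fun t =>
    intervalIntegral_mono_of_continuous zero_le_one (continuous_row hφ t) (continuous_row hχ t)
      fun _ => h _

/-- Wirtinger's inequality in the first variable. -/
lemma wirtinger_row (hy : 0 ≤ y) (hφ : ContDiff ℝ ∞ φ) (hper : IsPeriodic x y φ) :
    4 * Real.pi ^ 2 * (cellIntegral y (fun w => φ w ^ 2) - ∫ t in (0 : ℝ)..y, rowMean φ t ^ 2) ≤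
      cellIntegral y (fun w => pd 0 φ w ^ 2) := by
  have c0 := (contDiff_pd hφ 0).continuous
  have c2 := continuous_rowMean (hφ.pow 2).continuous
  have cm : Continuous fun t => rowMean φ t ^ 2 := (continuous_rowMean hφ.continuous).pow 2
  unfold cellIntegral
  rw [← intervalIntegral.integral_sub (c2.intervalIntegrable _ _)
    (cm.intervalIntegrable _ _), ← intervalIntegral.integral_const_mul]
  refine intervalIntegral_mono_of_continuous hy ((c2.sub cm).const_mul _)
    (continuous_rowMean (c0.pow 2)) fun t => ?_
  have h := wirtinger one_pos (fun s => hasDerivAt_pd_zero hφ s t) (continuous_row c0 t)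
    (by simpa using hper.row t 0)
  calc _ = (2 * Real.pi / 1) ^ 2 * ((∫ s in (0 : ℝ)..1, φ !₂[s, t] ^ 2) -
        (∫ s in (0 : ℝ)..1, φ !₂[s, t]) ^ 2 / 1) := by simp only [rowMean]; ring
    _ ≤ _ := h

/-- On the flat torus with lattice generated by `(1, 0)` and `(x, y)`, `y² ≥ 1/2`, the operator
`Δ²` dominates `-4π² (∂₀² + y⁻² ∂₁²)`. -/
theorem cellIntegral_laplacian_sq_ge (hy : 0 < y) (hy2 : 1 ≤ 2 * y ^ 2) (hφ : ContDiff ℝ ∞ φ)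
    (hper : IsPeriodic x y φ) :
    4 * Real.pi ^ 2 * (cellIntegral y (fun w => pd 0 φ w ^ 2) +
        1 / y ^ 2 * cellIntegral y (fun w => pd 1 φ w ^ 2)) ≤
      cellIntegral y (fun w => (pd 0 (pd 0 φ) w + pd 1 (pd 1 φ) w) ^ 2) := by
  have s0 := contDiff_pd hφ 0
  have s1 := contDiff_pd hφ 1
  have s00 := contDiff_pd s0 0
  have s11 := contDiff_pd s1 1
  have s01 := contDiff_pd s1 0
  have expand : cellIntegral y (fun w => (pd 0 (pd 0 φ) w + pd 1 (pd 1 φ) w) ^ 2) =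
      cellIntegral y (fun w => pd 0 (pd 0 φ) w ^ 2) +
        (2 * cellIntegral y (fun w => pd 0 (pd 1 φ) w ^ 2) +
          cellIntegral y (fun w => pd 1 (pd 1 φ) w ^ 2)) := by
    have e : (fun w => (pd 0 (pd 0 φ) w + pd 1 (pd 1 φ) w) ^ 2) = fun w =>
        pd 0 (pd 0 φ) w ^ 2 + (2 * (pd 0 (pd 0 φ) w * pd 1 (pd 1 φ) w) + pd 1 (pd 1 φ) w ^ 2) :=
      funext fun w => by ring
    have c := (s00.mul s11).continuous.const_mul 2
    have c' : Continuous fun w => 2 * (pd 0 (pd 0 φ) w * pd 1 (pd 1 φ) w) + pd 1 (pd 1 φ) w ^ 2 :=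
      c.add (s11.pow 2).continuous
    rw [e, cellIntegral_add (s00.pow 2).continuous c',
      cellIntegral_add c (s11.pow 2).continuous, cellIntegral_const_mul,
      cellIntegral_hessian hφ hper]
  -- `φ₀` has zero mean on each row, so no correction term survives in `w0`. For `φ₁` the correction
  -- is the integral `G` of the squared row means, to be recovered from `φ₁₁` in `w2`.
  have w0 := wirtinger_row hy.le s0 (hper.pd 0)
  simp only [rowMean_pd_zero hφ hper] at w0
  have w1 := wirtinger_row hy.le s1 (hper.pd 1)
  have cm := continuous_rowMean s1.continuous
  have jensen1 : ∫ t in (0 : ℝ)..y, rowMean (pd 1 φ) t ^ 2 ≤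
      cellIntegral y (fun w => pd 1 φ w ^ 2) :=
    intervalIntegral_mono_of_continuous hy.le (cm.pow 2)
      (continuous_rowMean (s1.pow 2).continuous) fun t =>
        sq_intervalIntegral_le (continuous_row s1.continuous t)
  have jensen11 : ∫ t in (0 : ℝ)..y, rowMean (pd 1 (pd 1 φ)) t ^ 2 ≤
      cellIntegral y (fun w => pd 1 (pd 1 φ) w ^ 2) :=
    intervalIntegral_mono_of_continuous hy.le ((continuous_rowMean s11.continuous).pow 2)
      (continuous_rowMean (s11.pow 2).continuous) fun t =>
        sq_intervalIntegral_le (continuous_row s11.continuous t)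
  have w2 := wirtinger hy (fun t => hasDerivAt_rowMean s1 t) (continuous_rowMean s11.continuous)
    (by simpa using (hper.pd 1).rowMean_add 0)
  have hz : ∫ t in (0 : ℝ)..y, rowMean (pd 1 φ) t = 0 := cellIntegral_pd_one hφ hper
  rw [hz] at w2
  rw [expand]
  simp only [ne_eq, OfNat.ofNat_ne_zero, not_false_eq_true, zero_pow, zero_div, sub_zero,
    intervalIntegral.integral_zero] at w0 w2
  set A := cellIntegral y (fun w => pd 1 φ w ^ 2)
  set G := ∫ t in (0 : ℝ)..y, rowMean (pd 1 φ) t ^ 2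
  -- The mixed term occurs twice in the expansion, so it bounds `2 (A - G)`; the target needs only
  -- `y⁻² (A - G)`, and the remaining `y⁻² G` comes from `w2`.
  have hinv : 1 / y ^ 2 ≤ 2 := by
    rw [div_le_iff₀ (by positivity)]; exact hy2
  have hk : 4 * Real.pi ^ 2 * (1 / y ^ 2 * (A - G)) ≤ 4 * Real.pi ^ 2 * (2 * (A - G)) :=
    mul_le_mul_of_nonneg_left (mul_le_mul_of_nonneg_right hinv (by linarith)) (by positivity)
  have hg : (2 * Real.pi / y) ^ 2 * G = 4 * Real.pi ^ 2 * (1 / y ^ 2 * G) := by ring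
  linarith

end cellIntegral

/-! ### The Willmore integrand in conformal coordinates -/

/-- The Laplacian of a function on the plane. -/
def laplacian {n : ℕ} (f : E 2 → E n) (w : E 2) : E n := pd 0 (pd 0 f) w + pd 1 (pd 1 f) w

/-- The map `f` is conformal, with conformal factor `lam`. -/
def IsConformal {n : ℕ} (f : E 2 → E n) (lam : E 2 → ℝ) : Prop :=
  ∀ w v v' : E 2, ⟪fderiv ℝ f w v, fderiv ℝ f w v'⟫ = lam w * ⟪v, v'⟫

lemma inner_stdVec (i j : Fin 2) : ⟪stdVec i, stdVec j⟫ = if i = j then (1 : ℝ) else 0 := by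
  fin_cases i <;> fin_cases j <;> simp [stdVec, EuclideanSpace.inner_single_left]

lemma eq_sum_stdVec (v : E 2) : v = v 0 • stdVec 0 + v 1 • stdVec 1 := by
  ext i
  fin_cases i <;> simp [stdVec]

section conformal

variable {n : ℕ} {f : E 2 → E n} {lam : E 2 → ℝ}

lemma IsConformal.inner_pd (h : IsConformal f lam) (i j : Fin 2) (w : E 2) :
    ⟪pd i f w, pd j f w⟫ = if i = j then lam w else 0 := by
  unfold pd
  rw [h, inner_stdVec]
  split_ifs <;> simp

lemma pd_inner {f g : E 2 → E n} (hf : ContDiff ℝ ∞ f) (hg : ContDiff ℝ ∞ g) (i : Fin 2)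
    (w : E 2) : pd i (fun w => ⟪f w, g w⟫) w = ⟪f w, pd i g w⟫ + ⟪pd i f w, g w⟫ := by
  unfold pd
  rw [fderiv_inner_apply ℝ (hf.differentiable (by simp) _) (hg.differentiable (by simp) _)]

/-- The Laplacian of a conformal map is normal. -/
lemma IsConformal.inner_laplacian (h : IsConformal f lam) (hf : ContDiff ℝ ∞ f) (w v : E 2) :
    ⟪laplacian f w, fderiv ℝ f w v⟫ = 0 := by
  have s0 := contDiff_pd hf 0
  have s1 := contDiff_pd hf 1
  -- Differentiating `|f₀|² = |f₁|²` and `⟪f₀, f₁⟫ = 0` in both directions gives, for instance,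
  -- `⟪f₀₀, f₀⟫ = ⟪f₀₁, f₁⟫ = -⟪f₁₁, f₀⟫`.
  have diag : (fun w => ⟪pd 0 f w, pd 0 f w⟫) = fun w => ⟪pd 1 f w, pd 1 f w⟫ := by
    funext w; simp only [h.inner_pd, if_true]
  have off : (fun w => ⟪pd 0 f w, pd 1 f w⟫) = fun _ => 0 := by
    funext w; simp [h.inner_pd]
  have d0 := congrFun (congrArg (pd 0) diag) w
  have d1 := congrFun (congrArg (pd 1) diag) w
  have o0 := congrFun (congrArg (pd 0) off) w
  have o1 := congrFun (congrArg (pd 1) off) w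
  rw [pd_inner s0 s0, pd_inner s1 s1, pd_comm hf 0 1] at d0
  rw [pd_inner s0 s0, pd_inner s1 s1, pd_comm hf 1 0] at d1
  rw [pd_inner s0 s1] at o0 o1
  rw [pd_comm hf 0 1] at o0
  rw [pd_comm hf 1 0] at o1
  have hz : ∀ i : Fin 2, pd i (fun _ : E 2 => (0 : ℝ)) w = 0 := fun i => by simp [pd]
  rw [hz] at o0 o1
  have c := fun a b : E n => real_inner_comm a b
  rw [pd_comm hf 1 0] at d0 o0
  have k0 : ⟪laplacian f w, pd 0 f w⟫ = 0 := by
    rw [laplacian, inner_add_left]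
    rw [c (pd 0 (pd 0 f) w), c (pd 0 (pd 1 f) w)] at d0
    rw [c (pd 1 (pd 1 f) w)] at o1
    linarith
  have k1 : ⟪laplacian f w, pd 1 f w⟫ = 0 := by
    rw [laplacian, inner_add_left]
    rw [c (pd 0 (pd 1 f) w), c (pd 1 (pd 1 f) w)] at d1
    rw [c (pd 0 (pd 1 f) w)] at o0
    linarith
  rw [eq_sum_stdVec v, map_add, map_smul, map_smul, inner_add_right, inner_smul_right,
    inner_smul_right]
  change v 0 * ⟪laplacian f w, pd 0 f w⟫ + v 1 * ⟪laplacian f w, pd 1 f w⟫ = 0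
  rw [k0, k1]
  ring

end conformal

/-! ### Mean curvature and area density under a change of parameters -/

section reparametrization

variable {n : ℕ} {h : E 2 → E n} {Φ : E 2 → E 2} {lam : E 2 → ℝ} {w : E 2}

/-- The Jacobian matrix. -/
def jacobian (Φ : E 2 → E 2) (w : E 2) : Matrix (Fin 2) (Fin 2) ℝ :=
  Matrix.of fun k i => fderiv ℝ Φ w (stdVec i) k

lemma det_fderiv (Φ : E 2 → E 2) (w : E 2) : (fderiv ℝ Φ w).det = (jacobian Φ w).det := by
  rw [ContinuousLinearMap.det, ← LinearMap.det_toMatrix (EuclideanSpace.basisFun (Fin 2) ℝ).toBasis]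
  congr 1

lemma fderiv_comp_reparam (hh : ContDiff ℝ ∞ h) (hΦ : ContDiff ℝ ∞ Φ) (w : E 2) :
    fderiv ℝ (h ∘ Φ) w = (fderiv ℝ h (Φ w)).comp (fderiv ℝ Φ w) :=
  fderiv_comp w (hh.differentiable (by simp) _) (hΦ.differentiable (by simp) _)

/-- The last term is tangent to the surface `h`, so the normal projection kills it; this makes the
second fundamental form tensorial. -/
lemma fderiv_fderiv_comp (hh : ContDiff ℝ ∞ h) (hΦ : ContDiff ℝ ∞ Φ) (w v v' : E 2) :
    fderiv ℝ (fderiv ℝ (h ∘ Φ)) w v v' =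
      fderiv ℝ (fderiv ℝ h) (Φ w) (fderiv ℝ Φ w v) (fderiv ℝ Φ w v') +
        fderiv ℝ h (Φ w) (fderiv ℝ (fderiv ℝ Φ) w v v') := by
  have hh' : Differentiable ℝ (fderiv ℝ h) :=
    (hh.fderiv_right (m := ∞) (by simp)).differentiable (by simp)
  have hΦ' : Differentiable ℝ (fderiv ℝ Φ) :=
    (hΦ.fderiv_right (m := ∞) (by simp)).differentiable (by simp)
  have hd : Differentiable ℝ Φ := hΦ.differentiable (by simp)
  have e : fderiv ℝ (h ∘ Φ) = fun w => (fderiv ℝ h (Φ w)).comp (fderiv ℝ Φ w) :=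
    funext (fderiv_comp_reparam hh hΦ)
  have h1 : HasFDerivAt (fun w => fderiv ℝ h (Φ w))
      ((fderiv ℝ (fderiv ℝ h) (Φ w)).comp (fderiv ℝ Φ w)) w :=
    (hh' (Φ w)).hasFDerivAt.comp w (hd w).hasFDerivAt
  rw [e, (h1.clm_comp (hΦ' w).hasFDerivAt).fderiv]
  simp [add_comm]

lemma fderiv_eq_jacobian (Φ : E 2 → E 2) (w : E 2) (i : Fin 2) :
    fderiv ℝ Φ w (stdVec i) = ∑ k, jacobian Φ w k i • stdVec k := by
  rw [Fin.sum_univ_two]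
  exact eq_sum_stdVec _

lemma firstFundamentalForm_comp (hh : ContDiff ℝ ∞ h) (hΦ : ContDiff ℝ ∞ Φ) (w : E 2) :
    firstFundamentalForm (h ∘ Φ) w =
      (jacobian Φ w).transpose * firstFundamentalForm h (Φ w) * jacobian Φ w := by
  ext i j
  simp only [firstFundamentalForm, Matrix.of_apply, fderiv_comp_reparam hh hΦ,
    ContinuousLinearMap.comp_apply, fderiv_eq_jacobian, map_add, map_smul, inner_add_left,
    inner_add_right, inner_smul_left, inner_smul_right, Matrix.mul_apply, Matrix.transpose_apply,
    Fin.sum_univ_two]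
  simp only [conj_trivial]
  ring

lemma IsConformal.firstFundamentalForm_eq {f : E 2 → E n} (hc : IsConformal f lam) (w : E 2) :
    firstFundamentalForm f w = lam w • (1 : Matrix (Fin 2) (Fin 2) ℝ) := by
  ext i j
  simp only [firstFundamentalForm, Matrix.of_apply, hc w, inner_stdVec, Matrix.smul_apply,
    Matrix.one_apply, smul_eq_mul]

/-- Conformality reads `Jᵀ g J = λ·1`. For square matrices a left inverse is a right inverse, so
`λ⁻¹ Jᵀ` can be moved to the right of `g J`. -/
lemma inv_firstFundamentalForm (hh : ContDiff ℝ ∞ h) (hΦ : ContDiff ℝ ∞ Φ)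
    (hc : IsConformal (h ∘ Φ) lam) (hlam : 0 < lam w) :
    (firstFundamentalForm h (Φ w))⁻¹ =
      (lam w)⁻¹ • (jacobian Φ w * (jacobian Φ w).transpose) := by
  have e := firstFundamentalForm_comp hh hΦ w
  rw [hc.firstFundamentalForm_eq] at e
  refine Matrix.inv_eq_right_inv ?_
  have h1 : ((lam w)⁻¹ • (jacobian Φ w).transpose) *
      (firstFundamentalForm h (Φ w) * jacobian Φ w) = 1 := by
    rw [Matrix.smul_mul, ← Matrix.mul_assoc, ← e, smul_smul, inv_mul_cancel₀ hlam.ne', one_smul]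
  have h2 := mul_eq_one_comm.mp h1
  rw [← h2, Matrix.mul_smul, Matrix.mul_smul, Matrix.mul_assoc]

lemma abs_det_mul_areaDensity (hh : ContDiff ℝ ∞ h) (hΦ : ContDiff ℝ ∞ Φ)
    (hc : IsConformal (h ∘ Φ) lam) (hlam : 0 < lam w) :
    |(fderiv ℝ Φ w).det| * areaDensity h (Φ w) = lam w := by
  have e := congrArg Matrix.det (firstFundamentalForm_comp hh hΦ w)
  rw [hc.firstFundamentalForm_eq] at e
  simp only [Matrix.det_smul, Matrix.det_one, Fintype.card_fin, mul_one, Matrix.det_mul,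
    Matrix.det_transpose] at e
  rw [det_fderiv, areaDensity, ← Real.sqrt_sq_eq_abs, ← Real.sqrt_mul (sq_nonneg _),
    show (jacobian Φ w).det ^ 2 * (firstFundamentalForm h (Φ w)).det = lam w ^ 2 by
      rw [e]; ring, Real.sqrt_sq hlam.le]

/-- A vector killed by `dΦ` has zero length in the conformal metric. Surjectivity shows that `h` and
`h ∘ Φ` have the same tangent plane, so a vector normal to one is normal to the other. -/
lemma surjective_fderiv (hh : ContDiff ℝ ∞ h) (hΦ : ContDiff ℝ ∞ Φ)
    (hc : IsConformal (h ∘ Φ) lam) (hlam : 0 < lam w) : Function.Surjective (fderiv ℝ Φ w) := by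
  have hinj : Function.Injective (fderiv ℝ Φ w).toLinearMap := by
    rw [← LinearMap.ker_eq_bot, LinearMap.ker_eq_bot']
    intro v hv
    have hv' : fderiv ℝ Φ w v = 0 := hv
    have e := hc w v v
    rw [fderiv_comp_reparam hh hΦ, ContinuousLinearMap.comp_apply, hv', map_zero,
      inner_zero_left] at e
    rcases mul_eq_zero.mp e.symm with h0 | h0
    · exact absurd h0 hlam.ne'
    · exact inner_self_eq_zero.mp h0
  exact LinearMap.injective_iff_surjective.mp hinj

/-- The mean curvature vector of a surface which becomes conformal after reparametrization. -/
lemma meanCurvature_eq (hh : ContDiff ℝ ∞ h) (hΦ : ContDiff ℝ ∞ Φ)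
    (hc : IsConformal (h ∘ Φ) lam) (hlam : 0 < lam w) :
    meanCurvature h (Φ w) = (1 / (2 * lam w)) • laplacian (h ∘ Φ) w := by
  set P := (normalSpace h (Φ w)).starProjection with hP
  have hker : ∀ v, P (fderiv ℝ h (Φ w) v) = 0 := fun v => by
    rw [hP, Submodule.starProjection_apply_eq_zero_iff]
    exact Submodule.le_orthogonal_orthogonal _ (LinearMap.mem_range_self _ v)
  have hfix : P (laplacian (h ∘ Φ) w) = laplacian (h ∘ Φ) w := by
    rw [hP, Submodule.starProjection_eq_self_iff, normalSpace, Submodule.mem_orthogonal']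
    rintro _ ⟨v, rfl⟩
    obtain ⟨v', rfl⟩ := surjective_fderiv hh hΦ hc hlam v
    have := hc.inner_laplacian (hh.comp hΦ) w v'
    rwa [fderiv_comp_reparam hh hΦ] at this
  have hsm := hh.comp hΦ
  rw [← hfix, laplacian, pd_pd hsm, pd_pd hsm, fderiv_fderiv_comp hh hΦ, fderiv_fderiv_comp hh hΦ]
  simp only [map_add, hker, add_zero]
  simp only [meanCurvature, secondFundamentalForm, ← hP, inv_firstFundamentalForm hh hΦ hc hlam,
    fderiv_eq_jacobian, Matrix.smul_apply, Matrix.mul_apply, Matrix.transpose_apply,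
    Fin.sum_univ_two, map_add, map_smul, add_apply,
    smul_apply, smul_eq_mul, smul_add, smul_smul]
  have : (1 / 2 : ℝ) * (lam w)⁻¹ = 1 / (2 * lam w) := by field_simp
  module

/-- The Willmore integrand, pulled back to conformal coordinates. -/
theorem abs_det_mul_willmoreIntegrand (hh : ContDiff ℝ ∞ h) (hΦ : ContDiff ℝ ∞ Φ)
    (hc : IsConformal (h ∘ Φ) lam) (hlam : 0 < lam w) :
    |(fderiv ℝ Φ w).det| * (‖meanCurvature h (Φ w)‖ ^ 2 * areaDensity h (Φ w)) =
      1 / (4 * lam w) * ‖laplacian (h ∘ Φ) w‖ ^ 2 := by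
  have e := abs_det_mul_areaDensity hh hΦ hc hlam
  rw [mul_left_comm, e, meanCurvature_eq hh hΦ hc hlam, norm_smul, mul_pow, Real.norm_eq_abs,
    sq_abs]
  field_simp
  ring

end reparametrization

/-! ### Lifting maps into the torus -/

lemma contDiff_coe_circle {c : E 2 → Circle} (hc : ContMDiff 𝓘(ℝ, E 2) (𝓡 1) ∞ c) :
    ContDiff ℝ ∞ fun w => (c w : ℂ) := by
  have h : ContMDiff (M := Circle) (𝓡 1) 𝓘(ℝ, ℂ) ∞ (fun c => (c : ℂ)) :=
    haveI := finrank_real_complex_fact'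
    contMDiff_coe_sphere
  exact contMDiff_iff_contDiff.mp (h.comp hc)

/-- A continuous angle function of a smooth map to the circle is smooth. -/
lemma contDiff_angle {c : E 2 → Circle} (hc : ContMDiff 𝓘(ℝ, E 2) (𝓡 1) ∞ c) {θ : E 2 → ℝ}
    (hθ : Continuous θ) (h : ∀ w, Circle.exp (θ w) = c w) : ContDiff ℝ ∞ θ := by
  have hz := contDiff_coe_circle hc
  have hexp : ∀ w, (c w : ℂ) = Complex.exp (θ w * Complex.I) := fun w => by
    rw [← h w, Circle.coe_exp]
  rw [contDiff_iff_contDiffAt]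
  intro w₀
  have hquot : ∀ w, (c w : ℂ) / c w₀ = Complex.exp ((θ w - θ w₀ : ℝ) * Complex.I) := fun w => by
    rw [hexp, hexp, ← Complex.exp_sub]
    push_cast
    ring_nf
  -- Near `w₀` the angle differs from `θ w₀` by less than `π`, so the principal logarithm recovers
  -- the difference exactly.
  have hev : θ =ᶠ[nhds w₀] fun w => θ w₀ + (Complex.log ((c w : ℂ) / c w₀)).im := by
    have hd : Filter.Tendsto (fun w => θ w - θ w₀) (nhds w₀) (nhds 0) := by
      simpa using (hθ.sub continuous_const).tendsto (x := w₀) (f := fun w => θ w - θ w₀)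
    filter_upwards [hd.eventually (Ioo_mem_nhds (neg_lt_zero.mpr Real.pi_pos) Real.pi_pos)] with w hw
    rw [hquot, Complex.log_exp (by simpa using hw.1) (by simpa using hw.2.le)]
    simp
  refine ContDiffAt.congr_of_eventuallyEq ?_ hev
  have hlog : ContDiffAt ℝ ∞ (fun w => Complex.log ((c w : ℂ) / c w₀)) w₀ := by
    have h1 : ContDiffAt ℝ ∞ (fun w => (c w : ℂ) / c w₀) w₀ :=
      (hz.div_const _).contDiffAt
    have h2 : ContDiffAt ℝ ∞ Complex.log ((c w₀ : ℂ) / c w₀) := by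
      refine (Complex.contDiffAt_log ?_).restrict_scalars ℝ
      rw [div_self (Circle.coe_ne_zero _)]
      exact Complex.one_mem_slitPlane
    exact h2.comp w₀ h1
  exact contDiffAt_const.add (Complex.imCLM.contDiff.contDiffAt.comp w₀ hlog)

/-- The plane is simply connected, so the map lifts through the covering `Circle.exp`. -/
lemma exists_angle {c : E 2 → Circle} (hc : ContMDiff 𝓘(ℝ, E 2) (𝓡 1) ∞ c) :
    ∃ θ : E 2 → ℝ, ContDiff ℝ ∞ θ ∧ ∀ w, Circle.exp (θ w) = c w := by
  obtain ⟨e₀, he₀⟩ := Circle.exp_surjective (c 0)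
  obtain ⟨θ, ⟨-, hθ⟩, -⟩ := Circle.isCoveringMap_exp.existsUnique_continuousMap_lifts
    (⟨c, hc.continuous⟩ : C(E 2, Circle)) 0 e₀ he₀
  have h : ∀ w, Circle.exp (θ w) = c w := fun w => congrFun hθ w
  exact ⟨θ, contDiff_angle hc θ.continuous h, h⟩

/-- Smooth maps from the plane to the torus lift through `angular`. -/
theorem exists_angular_lift {G : E 2 → T2} (hG : ContMDiff 𝓘(ℝ, E 2) T2Model ∞ G) :
    ∃ Φ : E 2 → E 2, ContDiff ℝ ∞ Φ ∧ ∀ w, angular (Φ w) = G w := by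
  obtain ⟨θ, hθ, h⟩ := exists_angle hG.fst
  obtain ⟨η, hη, h'⟩ := exists_angle hG.snd
  have hpi : 2 * Real.pi ≠ 0 := by positivity
  refine ⟨fun w => !₂[θ w / (2 * Real.pi), η w / (2 * Real.pi)], ?_, fun w => ?_⟩
  · rw [contDiff_euclidean]
    intro i
    fin_cases i
    · exact hθ.div_const _
    · exact hη.div_const _
  · simp only [angular]
    refine Prod.ext ?_ ?_
    · rw [← h w]; simp; field_simp
    · rw [← h' w]; simp; field_simp

lemma contMDiff_angular : ContMDiff 𝓘(ℝ, E 2) T2Model ∞ angular := by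
  have h : ∀ i : Fin 2, ContMDiff 𝓘(ℝ, E 2) (𝓡 1) ∞
      fun w : E 2 => Circle.exp (2 * Real.pi * w i) := fun i => by
    have h1 : ContDiff ℝ ∞ fun w : E 2 => 2 * Real.pi * w i := by fun_prop
    exact contMDiff_circleExp.comp h1.contMDiff
  exact (h 0).prodMk (h 1)

/-! ### Fundamental domains -/

/-- The lattice `ℤ²`. -/
def intLattice : Submodule ℤ (E 2) :=
  Submodule.span ℤ (range (EuclideanSpace.basisFun (Fin 2) ℝ).toBasis)

lemma mem_intLattice {v : E 2} : v ∈ intLattice ↔ ∀ i, ∃ k : ℤ, (k : ℝ) = v i := by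
  rw [intLattice, Module.Basis.mem_span_iff_repr_mem]
  simp

lemma angular_eq_iff {w w' : E 2} : angular w = angular w' ↔ w - w' ∈ intLattice := by
  have hpi : 2 * Real.pi ≠ 0 := by positivity
  have h : ∀ a b : ℝ, Circle.exp (2 * Real.pi * a) = Circle.exp (2 * Real.pi * b) ↔
      ∃ k : ℤ, (k : ℝ) = a - b := fun a b => by
    rw [Circle.exp_eq_exp]
    refine exists_congr fun k => ?_
    rw [show 2 * Real.pi * b + k * (2 * Real.pi) = 2 * Real.pi * (b + k) by ring,
      mul_right_inj' hpi, eq_sub_iff_add_eq, eq_comm, add_comm]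
  rw [angular, angular, Prod.mk.injEq, h, h, mem_intLattice, Fin.forall_fin_two]
  simp

instance : Countable intLattice := inferInstanceAs (Countable (Submodule.span ℤ (range _)))

lemma isAddFundamentalDomain_unitSquare :
    IsAddFundamentalDomain intLattice unitSquare (volume : Measure (E 2)) := by
  have h := ZSpan.isAddFundamentalDomain (EuclideanSpace.basisFun (Fin 2) ℝ).toBasis
    (volume : Measure (E 2))
  have e : unitSquare = ZSpan.fundamentalDomain (EuclideanSpace.basisFun (Fin 2) ℝ).toBasis := by
    ext w
    simp [unitSquare]
  rw [e]
  exact h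

/-- The half-open rectangle `[0, 1) × [0, y)`. -/
def cell (y : ℝ) : Set (E 2) := {w | w 0 ∈ Ico (0 : ℝ) 1 ∧ w 1 ∈ Ico (0 : ℝ) y}

lemma measurableSet_cell (y : ℝ) : MeasurableSet (cell y) := by
  have h : ∀ i : Fin 2, Measurable fun w : E 2 => w i := fun i => by fun_prop
  exact (h 0 measurableSet_Ico).inter (h 1 measurableSet_Ico)

lemma mem_lattice {x y : ℝ} {v : E 2} :
    v ∈ lattice x y ↔ ∃ k l : ℤ, v 0 = k + l * x ∧ v 1 = l * y := by
  rw [lattice, AddSubgroup.mem_closure_pair]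
  refine exists_congr fun k => exists_congr fun l => ?_
  constructor
  · rintro rfl
    simp
  · rintro ⟨h0, h1⟩
    ext i
    fin_cases i
    · simp [h0]
    · simp [h1]

lemma exists_mem_cell {x y : ℝ} (hy : 0 < y) (w : E 2) :
    ∃ w' ∈ cell y, w' - w ∈ lattice x y := by
  -- A multiple of `(x, y)` first brings the second coordinate into `[0, y)`; a multiple of `(1, 0)`
  -- then corrects the first one without disturbing it.
  set l : ℤ := -⌊w 1 / y⌋ with hl
  set k : ℤ := -⌊w 0 + l * x⌋ with hk
  refine ⟨!₂[w 0 + l * x + k, w 1 + l * y], ⟨⟨?_, ?_⟩, ⟨?_, ?_⟩⟩, mem_lattice.mpr ⟨k, l, ?_, ?_⟩⟩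
  · have := Int.floor_le (w 0 + l * x)
    simp only [hk, Int.cast_neg, Matrix.cons_val_zero]
    linarith
  · have := Int.lt_floor_add_one (w 0 + l * x)
    simp only [hk, Int.cast_neg, Matrix.cons_val_zero]
    linarith
  · have := (le_div_iff₀ hy).mp (Int.floor_le (w 1 / y))
    simp only [hl, Int.cast_neg, Matrix.cons_val_one, Matrix.cons_val_zero]
    linarith
  · have := (div_lt_iff₀ hy).mp (Int.lt_floor_add_one (w 1 / y))
    simp only [hl, Int.cast_neg, Matrix.cons_val_one, Matrix.cons_val_zero]
    linarith
  · simp; ring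
  · simp

lemma int_eq_zero_of_abs_lt_one {k : ℤ} (h : |(k : ℝ)| < 1) : k = 0 := by
  have : |k| < 1 := by exact_mod_cast h
  exact Int.abs_lt_one_iff.mp this

lemma eq_of_mem_cell {x y : ℝ} (hy : 0 < y) {w w' : E 2} (hw : w ∈ cell y) (hw' : w' ∈ cell y)
    (h : w - w' ∈ lattice x y) : w = w' := by
  obtain ⟨k, l, h0, h1⟩ := mem_lattice.mp h
  obtain ⟨⟨a0, b0⟩, a1, b1⟩ := hw
  obtain ⟨⟨a0', b0'⟩, a1', b1'⟩ := hw'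
  simp only [PiLp.sub_apply] at h0 h1
  have hl : l = 0 := by
    refine int_eq_zero_of_abs_lt_one (abs_lt.mpr ⟨?_, ?_⟩) <;> by_contra! hcon
    · nlinarith
    · nlinarith
  subst hl
  simp only [Int.cast_zero, zero_mul, add_zero] at h0 h1
  have hk : k = 0 := by
    refine int_eq_zero_of_abs_lt_one (abs_lt.mpr ⟨?_, ?_⟩) <;> linarith
  subst hk
  ext i
  fin_cases i
  · simpa [sub_eq_zero] using h0
  · simpa [sub_eq_zero] using h1

/-! ### The lifted cell as a fundamental domain of `ℤ²` -/

section lift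

variable {x y : ℝ} {ψ : FlatTorus x y ≃ₜ T2} {Φ : E 2 → E 2}

lemma comp_proj_eq_iff {w w' : E 2} :
    ψ (proj x y w) = ψ (proj x y w') ↔ w - w' ∈ lattice x y := by
  rw [ψ.injective.eq_iff, proj, proj, eq_comm, QuotientAddGroup.eq, neg_add_eq_sub]

lemma injOn_lift (hy : 0 < y) (h : ∀ w, angular (Φ w) = ψ (proj x y w)) : InjOn Φ (cell y) := by
  intro w hw w' hw' e
  refine eq_of_mem_cell (x := x) hy hw hw' ?_
  rw [← comp_proj_eq_iff (ψ := ψ), ← h, ← h, e]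

/-- The cell represents each point of the flat torus exactly once and `ψ` is bijective, so `angular
∘ Φ` maps the cell bijectively onto `T2`. Since the fibres of `angular` are the `ℤ²`-orbits, each
orbit meets the image exactly once. -/
lemma isAddFundamentalDomain_lift (hy : 0 < y) (hΦ : ContDiff ℝ ∞ Φ)
    (h : ∀ w, angular (Φ w) = ψ (proj x y w)) :
    IsAddFundamentalDomain intLattice (Φ '' cell y) (volume : Measure (E 2)) := by
  have hinj := injOn_lift hy h
  refine IsAddFundamentalDomain.mk' (measurable_image_of_fderivWithin (measurableSet_cell y)
    (fun w _ => (hΦ.differentiable (by simp) w).hasFDerivAt.hasFDerivWithinAt)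
    hinj).nullMeasurableSet fun p => ?_
  obtain ⟨q, hq⟩ := ψ.surjective (angular p)
  obtain ⟨w, rfl⟩ := QuotientAddGroup.mk_surjective q
  obtain ⟨w', hw', hmem⟩ := exists_mem_cell (x := x) hy w
  have e : angular (Φ w') = angular p := by
    rw [h, ← hq]
    exact comp_proj_eq_iff.mpr hmem
  refine ⟨⟨Φ w' - p, angular_eq_iff.mp e⟩, ⟨w', hw', ?_⟩, ?_⟩
  · simp [Submodule.vadd_def]
  · rintro ⟨g, hg⟩ ⟨w'', hw'', e''⟩
    have e3 : Φ w'' = g + p := e''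
    have e4 : angular (Φ w'') = angular (Φ w') := by
      rw [e, angular_eq_iff, e3, add_sub_cancel_right]
      exact hg
    have e5 : w'' = w' := by
      refine eq_of_mem_cell (x := x) hy hw'' hw' ?_
      rw [← comp_proj_eq_iff (ψ := ψ), ← h, ← h, e4]
    refine Subtype.ext ?_
    simp only
    rw [← e5, e3, add_sub_cancel_right]

end lift

/-! ### Integrals over the cell -/

lemma setIntegral_cell {y : ℝ} (hy : 0 ≤ y) {φ : E 2 → ℝ} (hφ : Continuous φ) :
    ∫ w in cell y, φ w = cellIntegral y φ := by
  have hmp : MeasurePreserving ((MeasurableEquiv.toLp 2 (Fin 2 → ℝ)).symm.trans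
      MeasurableEquiv.finTwoArrow) (volume : Measure (E 2)) (volume : Measure (ℝ × ℝ)) :=
    (volume_preserving_finTwoArrow ℝ).comp
      (EuclideanSpace.volume_preserving_symm_measurableEquiv_toLp (Fin 2))
  have h := hmp.setIntegral_preimage_emb (MeasurableEquiv.measurableEmbedding _)
    (fun p : ℝ × ℝ => φ !₂[p.1, p.2]) (Ico 0 1 ×ˢ Ico 0 y)
  have hc : Continuous fun p : ℝ × ℝ => φ !₂[p.1, p.2] := by fun_prop
  have hint : IntegrableOn (fun p : ℝ × ℝ => φ !₂[p.1, p.2]) (Icc 0 1 ×ˢ Icc 0 y) :=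
    hc.continuousOn.integrableOn_compact (isCompact_Icc.prod isCompact_Icc)
  have e1 : ∫ w in cell y, φ w = ∫ p in Ico (0 : ℝ) 1 ×ˢ Ico (0 : ℝ) y, φ !₂[p.1, p.2] := by
    rw [← h]
    have hs : ((MeasurableEquiv.toLp 2 (Fin 2 → ℝ)).symm.trans MeasurableEquiv.finTwoArrow) ⁻¹'
        (Ico (0 : ℝ) 1 ×ˢ Ico (0 : ℝ) y) = cell y := rfl
    rw [hs]
    refine setIntegral_congr_fun (measurableSet_cell y) fun w _ => ?_
    congr 1
    ext i
    fin_cases i <;> rfl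
  rw [e1, Measure.volume_eq_prod, setIntegral_prod _
    (hint.mono_set (prod_mono Ico_subset_Icc_self Ico_subset_Icc_self))]
  simp only [integral_Ico_eq_integral_Ioc]
  simp only [← intervalIntegral.integral_of_le hy]
  rw [← intervalIntegral.integral_of_le zero_le_one, cellIntegral]
  refine intervalIntegral_intervalIntegral_swap (hint.mono_set ?_)
  rw [uIoc_of_le zero_le_one, uIoc_of_le hy]
  exact prod_mono Ioc_subset_Icc_self Ioc_subset_Icc_self

/-! ### Conformal maps of flat tori into Euclidean space -/

section vector

variable {n : ℕ} {x y : ℝ} {f : E 2 → E n} {lam : E 2 → ℝ}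

lemma pd_coord (hf : ContDiff ℝ ∞ f) (i : Fin 2) (j : Fin n) :
    pd i (fun w => f w j) = fun w => pd i f w j := by
  funext w
  have h := (hf.differentiable (by simp) w).hasFDerivAt
  have h' : HasFDerivAt (fun w => f w j) ((EuclideanSpace.proj (𝕜 := ℝ) j).comp (fderiv ℝ f w)) w :=
    (EuclideanSpace.proj (𝕜 := ℝ) j).hasFDerivAt.comp w h
  rw [pd, h'.fderiv]
  rfl

lemma contDiff_coord (hf : ContDiff ℝ ∞ f) (j : Fin n) : ContDiff ℝ ∞ fun w => f w j :=
  contDiff_euclidean.mp hf j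

lemma contDiff_laplacian (hf : ContDiff ℝ ∞ f) : ContDiff ℝ ∞ (laplacian f) :=
  (contDiff_pd (contDiff_pd hf 0) 0).add (contDiff_pd (contDiff_pd hf 1) 1)

lemma cellIntegral_sum {ι : Type*} (s : Finset ι) {φ : ι → E 2 → ℝ}
    (hφ : ∀ j, Continuous (φ j)) :
    cellIntegral y (fun w => ∑ j ∈ s, φ j w) = ∑ j ∈ s, cellIntegral y (φ j) := by
  classical
  induction s using Finset.induction_on with
  | empty => simp [cellIntegral, rowMean]
  | insert a s ha ih =>
    simp only [Finset.sum_insert ha]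
    rw [cellIntegral_add (hφ a) (continuous_finsetSum s fun j _ => hφ j), ih]

lemma cellIntegral_norm_sq {g : E 2 → E n} (hg : ContDiff ℝ ∞ g) :
    cellIntegral y (fun w => ‖g w‖ ^ 2) = ∑ j, cellIntegral y (fun w => g w j ^ 2) := by
  rw [← cellIntegral_sum _ fun j => ((contDiff_coord hg j).pow 2).continuous]
  simp only [EuclideanSpace.norm_sq_eq, Real.norm_eq_abs, sq_abs]

/-- The second order Wirtinger inequality for vector valued maps. -/
lemma cellIntegral_norm_laplacian_sq_ge (hy : 0 < y) (hy2 : 1 ≤ 2 * y ^ 2)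
    (hf : ContDiff ℝ ∞ f) (hper : IsPeriodic x y f) :
    4 * Real.pi ^ 2 * (cellIntegral y (fun w => ‖pd 0 f w‖ ^ 2) +
        1 / y ^ 2 * cellIntegral y (fun w => ‖pd 1 f w‖ ^ 2)) ≤
      cellIntegral y (fun w => ‖laplacian f w‖ ^ 2) := by
  rw [cellIntegral_norm_sq (contDiff_pd hf 0), cellIntegral_norm_sq (contDiff_pd hf 1),
    cellIntegral_norm_sq (contDiff_laplacian hf), Finset.mul_sum, ← Finset.sum_add_distrib,
    Finset.mul_sum]
  refine Finset.sum_le_sum fun j _ => ?_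
  have h := cellIntegral_laplacian_sq_ge hy hy2 (contDiff_coord hf j) (x := x)
    ⟨fun w => by simp only [hper.1 w], fun w => by simp only [hper.2 w]⟩
  simp only [pd_coord hf, pd_coord (contDiff_pd hf _)] at h
  exact h

lemma IsConformal.norm_pd_sq (hc : IsConformal f lam) (i : Fin 2) (w : E 2) :
    ‖pd i f w‖ ^ 2 = lam w := by
  rw [← real_inner_self_eq_norm_sq, hc.inner_pd, if_pos rfl]

/-- The lower bound for the Willmore energy of a conformal map in terms of bounds `a ≤ λ ≤ b` for
the conformal factor. -/
theorem IsConformal.cellIntegral_willmore_ge (hc : IsConformal f lam) (hy : 0 < y)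
    (hy2 : 1 ≤ 2 * y ^ 2) (hf : ContDiff ℝ ∞ f) (hper : IsPeriodic x y f)
    (hlam : Continuous lam) {a b : ℝ} (ha : 0 < a) (hab : ∀ w, a ≤ lam w ∧ lam w ≤ b) :
    a / b * (Real.pi ^ 2 * (y + 1 / y)) ≤
      cellIntegral y (fun w => 1 / (4 * lam w) * ‖laplacian f w‖ ^ 2) := by
  have hpos : ∀ w, 0 < lam w := fun w => ha.trans_le (hab w).1
  have hb : 0 < b := (hpos 0).trans_le (hab 0).2
  have hL : Continuous fun w => ‖laplacian f w‖ ^ 2 :=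
    (contDiff_laplacian hf).continuous.norm.pow 2
  have hcont : Continuous fun w => 1 / (4 * lam w) * ‖laplacian f w‖ ^ 2 :=
    (continuous_const.div (hlam.const_mul 4) fun w => by have := hpos w; positivity).mul hL
  have h1 : 1 / (4 * b) * cellIntegral y (fun w => ‖laplacian f w‖ ^ 2) ≤
      cellIntegral y (fun w => 1 / (4 * lam w) * ‖laplacian f w‖ ^ 2) := by
    rw [← cellIntegral_const_mul]
    refine cellIntegral_mono hy.le (hL.const_mul _) hcont fun w => ?_
    refine mul_le_mul_of_nonneg_right ?_ (sq_nonneg _)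
    have := hpos w
    exact one_div_le_one_div_of_le (by positivity) (by linarith [(hab w).2])
  have h2 : a * y ≤ cellIntegral y lam := by
    have := cellIntegral_mono hy.le continuous_const hlam fun w => (hab w).1
    have e : cellIntegral y (fun _ => a) = a * y := by
      simp [cellIntegral, rowMean, mul_comm]
    rwa [e] at this
  have h3 := cellIntegral_norm_laplacian_sq_ge hy hy2 hf hper
  -- Conformality turns both gradient integrals into `∫ λ`, so the bound no longer involves `f` on
  -- its left side.
  simp only [hc.norm_pd_sq] at h3
  calc a / b * (Real.pi ^ 2 * (y + 1 / y))
      = 1 / (4 * b) * (4 * Real.pi ^ 2 * (1 + 1 / y ^ 2) * (a * y)) := by field_simp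
    _ ≤ 1 / (4 * b) * (4 * Real.pi ^ 2 * (1 + 1 / y ^ 2) * cellIntegral y lam) := by gcongr
    _ ≤ 1 / (4 * b) * cellIntegral y (fun w => ‖laplacian f w‖ ^ 2) := by
        refine mul_le_mul_of_nonneg_left ?_ (by positivity)
        linarith
    _ ≤ _ := h1

end vector

/-! ### The Willmore functional in conformal coordinates -/

section willmore

variable {n : ℕ} {x y : ℝ} {F : T2 → E n} {ψ : FlatTorus x y ≃ₜ T2}

lemma angular_add_of_mem_intLattice {g : E 2} (hg : g ∈ intLattice) (w : E 2) :
    angular (g + w) = angular w := by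
  rwa [angular_eq_iff, add_sub_cancel_right]

/-- The Willmore integrand in angular coordinates is invariant under `ℤ²`. -/
lemma willmoreIntegrand_vadd (F : T2 → E n) (g : intLattice) (w : E 2) :
    ‖meanCurvature (F ∘ angular) (g +ᵥ w)‖ ^ 2 * areaDensity (F ∘ angular) (g +ᵥ w) =
      ‖meanCurvature (F ∘ angular) w‖ ^ 2 * areaDensity (F ∘ angular) w := by
  have h : ∀ w, (F ∘ angular) (w + g) = (F ∘ angular) w := fun w => by
    rw [Function.comp, add_comm, angular_add_of_mem_intLattice g.2, Function.comp]
  have e : (g +ᵥ w : E 2) = w + g := by rw [Submodule.vadd_def, vadd_eq_add, add_comm]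
  have d1 : ∀ w, fderiv ℝ (F ∘ angular) (w + g) = fderiv ℝ (F ∘ angular) w := fun w => by
    rw [← fderiv_comp_add_right, funext h]
  have d2 : fderiv ℝ (fderiv ℝ (F ∘ angular)) (w + g) =
      fderiv ℝ (fderiv ℝ (F ∘ angular)) w := by
    rw [← fderiv_comp_add_right, funext d1]
  simp only [e, meanCurvature, areaDensity, secondFundamentalForm, firstFundamentalForm,
    normalSpace, d1, d2]

/-- The Willmore functional, computed in conformal coordinates. -/
theorem willmore_eq_cellIntegral (hy : 0 < y) (hF : ContMDiff T2Model 𝓘(ℝ, E n) ∞ F)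
    (hψ : IsDiffeo ψ) {lam : E 2 → ℝ} (hlam : Continuous lam) (hpos : ∀ w, 0 < lam w)
    (hc : IsConformal (F ∘ ψ ∘ proj x y) lam) :
    willmore F =
      cellIntegral y (fun w => 1 / (4 * lam w) * ‖laplacian (F ∘ ψ ∘ proj x y) w‖ ^ 2) := by
  obtain ⟨Φ, hΦ, hlift⟩ := exists_angular_lift hψ.contMDiff
  have hh : ContDiff ℝ ∞ (F ∘ angular) := contMDiff_iff_contDiff.mp (hF.comp contMDiff_angular)
  have e : F ∘ ψ ∘ proj x y = (F ∘ angular) ∘ Φ := funext fun w => congrArg F (hlift w).symm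
  rw [e] at hc ⊢
  have hcont : Continuous fun w =>
      1 / (4 * lam w) * ‖laplacian ((F ∘ angular) ∘ Φ) w‖ ^ 2 :=
    (continuous_const.div (hlam.const_mul 4) fun w => by have := hpos w; positivity).mul
      ((contDiff_laplacian (hh.comp hΦ)).continuous.norm.pow 2)
  have : VAddInvariantMeasure intLattice (E 2) volume :=
    inferInstanceAs (VAddInvariantMeasure intLattice.toAddSubgroup (E 2) volume)
  -- By `ℤ²`-invariance of the integrand, the unit square may be exchanged for `Φ '' cell y`; `Φ` is
  -- injective on the cell, so the integral then pulls back.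
  rw [willmore, isAddFundamentalDomain_unitSquare.setIntegral_eq
      (isAddFundamentalDomain_lift hy hΦ hlift) (willmoreIntegrand_vadd F),
    integral_image_eq_integral_abs_det_fderiv_smul volume (measurableSet_cell y)
      (fun w _ => (hΦ.differentiable (by simp) w).hasFDerivAt.hasFDerivWithinAt)
      (injOn_lift hy hlift), ← setIntegral_cell hy.le hcont]
  exact setIntegral_congr_fun (measurableSet_cell y) fun w _ =>
    abs_det_mul_willmoreIntegrand hh hΦ hc (hpos w)

lemma fderiv_comp_eq_mfderiv (hF : ContMDiff T2Model 𝓘(ℝ, E n) ∞ F) {G : E 2 → T2}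
    (hG : ContMDiff 𝓘(ℝ, E 2) T2Model ∞ G) (w v : E 2) :
    fderiv ℝ (F ∘ G) w v =
      mfderiv T2Model 𝓘(ℝ, E n) F (G w) (mfderiv 𝓘(ℝ, E 2) T2Model G w v) := by
  rw [← mfderiv_eq_fderiv, mfderiv_comp w (hF.mdifferentiable (by simp) _)
    (hG.mdifferentiable (by simp) _)]
  rfl

lemma isPeriodic_comp_proj {V : Type*} (g : FlatTorus x y → V) : IsPeriodic x y (g ∘ proj x y) := by
  have h : ∀ c ∈ lattice x y, ∀ w, (g ∘ proj x y) (w + c) = (g ∘ proj x y) w := fun c hc w => by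
    simp only [Function.comp, proj]
    rw [QuotientAddGroup.mk_add_of_mem w hc]
  exact ⟨h _ (AddSubgroup.subset_closure (by simp)), h _ (AddSubgroup.subset_closure (by simp))⟩

end willmore

end WillmoreTorus

end

/-! ### The Willmore bound -/

theorem mainTheorem4 (n : ℕ) (F : WillmoreTorus.T2 → WillmoreTorus.E n)
    (hF : WillmoreTorus.IsSmoothImmersion F)
    (x y : ℝ) (hxy : (x, y) ∈ WillmoreTorus.moduliDomain)
    (u : WillmoreTorus.FlatTorus x y → ℝ) (hu : WillmoreTorus.IsSmooth u)
    (hiso : WillmoreTorus.InducedMetricIsometric F x y u) :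
    WillmoreTorus.willmore F ≥
      Real.exp (-2 * WillmoreTorus.osc u) * (Real.pi ^ 2 * (y + 1 / y)) := by
  open WillmoreTorus in
  obtain ⟨ψ, hψ, hmetric⟩ := hiso
  obtain ⟨hx0, hx1, hn, hy0⟩ := hxy
  simp only at hx0 hx1 hn hy0
  -- In fact `y² ≥ 1 - x² ≥ 3/4`; the weaker bound is all that the spectral inequality needs.
  have hy2 : 1 ≤ 2 * y ^ 2 := by nlinarith
  have hy : 0 < y := lt_of_le_of_ne hy0 fun h => by rw [← h] at hy2; norm_num at hy2
  have hFs := hF.contMDiff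
  have hu' : Continuous (u ∘ proj x y) := ContDiff.continuous hu
  have huc : Continuous u := isQuotientMap_quot_mk.continuous_iff.mpr hu'
  -- Compactness, transported from `T2`, makes the range of `u` bounded, so the supremum and infimum
  -- in `osc` are genuine bounds.
  have : CompactSpace (FlatTorus x y) := ψ.symm.compactSpace
  have hbd := isCompact_range huc
  set lam : E 2 → ℝ := fun w => Real.exp (2 * u (proj x y w)) with hlam
  have hlamc : Continuous lam := Real.continuous_exp.comp (hu'.const_mul 2)
  have hc : IsConformal (F ∘ ψ ∘ proj x y) lam := fun w v v' => by
    rw [fderiv_comp_eq_mfderiv hFs hψ.contMDiff, fderiv_comp_eq_mfderiv hFs hψ.contMDiff]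
    exact hmetric w v v'
  have hf : ContDiff ℝ ∞ (F ∘ ψ ∘ proj x y) :=
    contMDiff_iff_contDiff.mp (hFs.comp hψ.contMDiff)
  rw [ge_iff_le, willmore_eq_cellIntegral hy hFs hψ hlamc (fun w => Real.exp_pos _) hc]
  have key := hc.cellIntegral_willmore_ge hy hy2 hf (isPeriodic_comp_proj (F ∘ ψ)) hlamc
    (Real.exp_pos (2 * ⨅ p, u p)) (b := Real.exp (2 * ⨆ p, u p)) fun w =>
      ⟨Real.exp_le_exp.mpr (by linarith [ciInf_le hbd.bddBelow (proj x y w)]),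
        Real.exp_le_exp.mpr (by linarith [le_ciSup hbd.bddAbove (proj x y w)])⟩
  rwa [← Real.exp_sub, show 2 * (⨅ p, u p) - 2 * (⨆ p, u p) = -2 * osc u by
    rw [osc]; ring] at key
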